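/- Let $\sigma,K,T,\lambda>0$ and $r\in\mathbb R$. Put $h(x)=(K-e^x)^+$, $R(\pi)=\pi-\pi\log\pi$, $H(x,\pi,v)=(h(x)-v)\pi+\lambda R(\pi)$ and $\mathcal L f=\tfrac12\sigma^2 f''+(r-\tfrac12\sigma^2)f'-rf$. By a solution of a terminal value problem below we mean a classical one, that is, a function $u\in C^{2,1}(\mathbb R\times(0,T))\cap C(\mathbb R\times[0,T])$ that satisfies the equation on $\mathbb R\times(0,T)$ and the terminal condition on $\mathbb R$, and has at most exponential growth in $x$: $|u(x,t)|\le Ae^{B|x|}$ on $\mathbb R\times[0,T]$ for some constants $A,B$ (in particular, bounded classical solutions are included). Let $u^\lambda$ (the optimal value function) be a solution of $$\partial_t u^\lambda+\mathcal L u^\lambda+\lambda\exp\Big(-\frac{u^\lambda-h}{\lambda}\Big)=0,\qquad u^\lambda(x,T)=h(x).$$ Let $u^0:\mathbb R\to\mathbb R$ be any bounded continuous function, regarded as a function of $(x,t)$ that does not depend on $t$, and let $(u^n,\pi^n)_{n\ge1}$ be generated from it by policy iteration: for every $n\ge0$, $$\pi^{n+1}(x,t)=\exp\Big(-\frac{u^n(x,t)-h(x)}{\lambda}\Big)\qquad\text{on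 }\mathbb R\times[0,T],$$ which is the unique maximizer of $\pi\mapsto H(x,\pi,u^n(x,t))$ over $(0,\infty)$, and $u^{n+1}$ is a solution of the linear problem $$\partial_t u^{n+1}+\mathcal L u^{n+1}+H\big(x,\pi^{n+1}(x,t),u^{n+1}\big)=0,\qquad u^{n+1}(x,T)=h(x).$$ Then for every $n\ge1$, $$u^n(x,t)\le u^{n+1}(x,t)\le u^\lambda(x,t)\qquad\text{for all }(x,t)\in\mathbb R\times[0,T].$$ -/

import Mathlib

open Set
open scoped BoundedContinuousFunction

noncomputable section

namespace ExploratoryStopping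

/-- Payoff of the put with strike `K` in the log-price variable: `h(x) = (K - e^x)^+`. -/
def payoff (K x : ℝ) : ℝ := max (K - Real.exp x) 0

/-- The entropy term `R(p) = p - p log p`. -/
def entropyTerm (p : ℝ) : ℝ := p - p * Real.log p

/-- The Hamiltonian `H(x, p, v) = (h(x) - v) p + lam R(p)`. -/
def hamiltonian (K lam x p v : ℝ) : ℝ := (payoff K x - v) * p + lam * entropyTerm p

/-- The Black-Scholes operator in log-price,
`L f = (σ² / 2) f'' + (r - σ² / 2) f' - r f`. -/
def opL (σ r : ℝ) (f : ℝ → ℝ) (x : ℝ) : ℝ :=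
  σ ^ 2 / 2 * deriv (deriv f) x + (r - σ ^ 2 / 2) * deriv f x - r * f x

/-- The improved policy at the point `x` when the current value there is `v`:
`exp (-(v - h(x)) / lam)`. -/
def improvedPolicy (K lam x v : ℝ) : ℝ := Real.exp (-(v - payoff K x) / lam)

/-- `improvedPolicy` is the unique maximizer of the Hamiltonian over `p ∈ (0, ∞)`. -/
theorem hamiltonian_lt_improvedPolicy {K lam x v p : ℝ} (hlam : 0 < lam) (hp : 0 < p)
    (hne : p ≠ improvedPolicy K lam x v) :
    hamiltonian K lam x p v < hamiltonian K lam x (improvedPolicy K lam x v) v := by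
  have hq : 0 < improvedPolicy K lam x v := Real.exp_pos _
  have hlog : payoff K x - v = lam * Real.log (improvedPolicy K lam x v) := by
    simp only [improvedPolicy, Real.log_exp]
    field_simp
    ring
  generalize improvedPolicy K lam x v = q at *
  have h1 : Real.log (q / p) < q / p - 1 := by
    apply Real.log_lt_sub_one_of_pos (by positivity)
    intro h
    exact hne ((div_eq_one_iff_eq hp.ne').1 h).symm
  rw [Real.log_div hq.ne' hp.ne'] at h1
  have h2 : p * (Real.log q - Real.log p) < q - p := by
    have := mul_lt_mul_of_pos_left h1 hp
    have e : p * (q / p - 1) = q - p := by field_simp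
    linarith
  simp only [hamiltonian, entropyTerm, hlog]
  nlinarith [mul_lt_mul_of_pos_left h2 hlam]

/-- `u ∈ C^{2,1}(ℝ × (0,T))`: the derivatives `u_t`, `u_x`, `u_xx` exist and are jointly
continuous there. The first argument of `u` is the space variable, the second one is time. -/
structure IsC21 (T : ℝ) (u : ℝ → ℝ → ℝ) : Prop where
  differentiableAt_time : ∀ x, ∀ t ∈ Ioo 0 T, DifferentiableAt ℝ (fun s => u x s) t
  contDiff_space : ∀ t ∈ Ioo 0 T, ContDiff ℝ 2 (fun y => u y t)
  continuousOn_dt :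
    ContinuousOn (fun z : ℝ × ℝ => deriv (fun s => u z.1 s) z.2) (univ ×ˢ Ioo 0 T)
  continuousOn_dx :
    ContinuousOn (fun z : ℝ × ℝ => deriv (fun y => u y z.2) z.1) (univ ×ˢ Ioo 0 T)
  continuousOn_dxx :
    ContinuousOn (fun z : ℝ × ℝ => deriv (deriv (fun y => u y z.2)) z.1) (univ ×ˢ Ioo 0 T)

/-- `u` is a classical solution of the terminal value problem
`u_t + L u + F(x, t, u) = 0` on `ℝ × (0,T)`, `u(x, T) = h(x)`:
it lies in `C^{2,1}(ℝ × (0,T)) ∩ C(ℝ × [0,T])`, and it belongs to the class of functions of at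
most exponential growth in `x` (which contains the bounded ones). Some growth restriction is
always understood in a Cauchy problem on the whole line, since without one
solutions are not unique. -/
structure IsClassicalSolution (σ r K T : ℝ) (F : ℝ → ℝ → ℝ → ℝ) (u : ℝ → ℝ → ℝ) : Prop where
  continuousOn : ContinuousOn (fun z : ℝ × ℝ => u z.1 z.2) (univ ×ˢ Icc 0 T)
  isC21 : IsC21 T u
  growth : ∃ A B : ℝ, ∀ x, ∀ t ∈ Icc 0 T, |u x t| ≤ A * Real.exp (B * |x|)
  pde : ∀ x, ∀ t ∈ Ioo 0 T,
    deriv (fun s => u x s) t + opL σ r (fun y => u y t) x + F x t (u x t) = 0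
  terminal : ∀ x, u x T = payoff K x

/-- `u` is the value function of the feedback policy `p`: it solves the linear equation
`u_t + L u + H(x, p(x,t), u) = 0`, `u(x, T) = h(x)`. -/
def IsValueFunction (σ r K T lam : ℝ) (p u : ℝ → ℝ → ℝ) : Prop :=
  IsClassicalSolution σ r K T (fun x t v => hamiltonian K lam x (p x t) v) u

/-- `u` is the optimal value function: it solves the Hamilton-Jacobi-Bellman equation
`u_t + L u + lam exp (-(u - h) / lam) = 0`, `u(x, T) = h(x)`. -/
def IsOptimalValueFunction (σ r K T lam : ℝ) (u : ℝ → ℝ → ℝ) : Prop :=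
  IsClassicalSolution σ r K T (fun x _ v => lam * Real.exp (-(v - payoff K x) / lam)) u

/-- `(u n, p n)` is generated by policy iteration from the time-independent initial guess `u0`:
policy update `p (n+1) = exp (-(u n - h) / lam)`, policy evaluation: `u (n+1)` is the value
function of `p (n+1)`. (`p 0` plays no role.) -/
structure IsPolicyIteration (σ r K T lam : ℝ) (u0 : ℝ →ᵇ ℝ) (u p : ℕ → ℝ → ℝ → ℝ) : Prop where
  init : ∀ x, ∀ t ∈ Icc 0 T, u 0 x t = u0 x
  update : ∀ n x, ∀ t ∈ Icc 0 T, p (n + 1) x t = improvedPolicy K lam x (u n x t)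
  evaluation : ∀ n, IsValueFunction σ r K T lam (p (n + 1)) (u (n + 1))

end ExploratoryStopping

end

open Filter Topology

namespace ExploratoryStopping

/-! The Hamiltonian is affine in `v` with slope `-p`. So the difference `w` of two successive
values, or of the optimal value and an iterate, solves a linear equation with killing rate the newer
policy, `p > 0`. Its source has a sign because the improved policy maximizes the Hamiltonian, whose
maximum is the HJB nonlinearity. Thus `w` is a supersolution with zero terminal value, and the
minimum principle `nonneg_of_supersolution` gives `w ≥ 0`.

That principle uses only the sign of the killing rate, which need not be bounded. The `cosh` barrier
absorbs both the exponential growth of `w` and a possibly negative `r`. -/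

/-- Were the second derivative negative, the point would also be a local maximum, so `f` would be
locally constant. -/
theorem nonneg_deriv_deriv_of_isLocalMin {f : ℝ → ℝ} {x : ℝ} (hf : ContDiff ℝ 2 f)
    (h : IsLocalMin f x) : 0 ≤ deriv (deriv f) x := by
  by_contra! hneg
  have hmax : IsLocalMax f x :=
    isLocalMax_of_deriv_deriv_neg hneg h.deriv_eq_zero hf.continuous.continuousAt
  have hconst : f =ᶠ[𝓝 x] fun _ => f x := by
    filter_upwards [h, hmax] with y h1 h2 using le_antisymm h2 h1
  have h0 : deriv (deriv f) x = 0 := by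
    have h1 : deriv f =ᶠ[𝓝 x] deriv fun _ => f x := hconst.deriv
    rw [h1.deriv_eq]
    simp
  linarith

/-- One-sided, since the minimum over the box below may lie on its initial time face. -/
theorem nonneg_deriv_of_forall_Ico_le {f : ℝ → ℝ} {a b : ℝ} (hab : a < b)
    (hf : DifferentiableAt ℝ f a) (h : ∀ t ∈ Ico a b, f a ≤ f t) : 0 ≤ deriv f a := by
  have hs : Tendsto (slope f a) (𝓝[>] a) (𝓝 (deriv f a)) :=
    hf.hasDerivAt.tendsto_slope.mono_left (nhdsWithin_mono _ fun y hy => ne_of_gt hy)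
  refine ge_of_tendsto hs ?_
  filter_upwards [Ioo_mem_nhdsGT hab] with t ht
  rw [slope_def_field]
  exact div_nonneg (sub_nonneg.2 (h t ⟨ht.1.le, ht.2⟩)) (sub_nonneg.2 ht.1.le)

/-- The operator `opL` of a sum. -/
theorem opL_add (σ r : ℝ) {f g : ℝ → ℝ} (hf : ContDiff ℝ 2 f) (hg : ContDiff ℝ 2 g) (x : ℝ) :
    opL σ r (fun y => f y + g y) x = opL σ r f x + opL σ r g x := by
  have h1 : deriv (fun y => f y + g y) = fun y => deriv f y + deriv g y := by
    funext y
    exact deriv_fun_add (hf.differentiable two_ne_zero y) (hg.differentiable two_ne_zero y)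
  have h2 : deriv (fun y => deriv f y + deriv g y) x = deriv (deriv f) x + deriv (deriv g) x :=
    deriv_fun_add (hf.differentiable_deriv_two x) (hg.differentiable_deriv_two x)
  simp only [opL, h1, h2]
  ring

theorem opL_const_mul (σ r c : ℝ) (f : ℝ → ℝ) (x : ℝ) :
    opL σ r (fun y => c * f y) x = c * opL σ r f x := by
  have h1 : deriv (fun y => c * f y) = fun y => c * deriv f y := by
    funext y
    exact deriv_const_mul_field c
  have h2 : deriv (fun y => c * deriv f y) x = c * deriv (deriv f) x := deriv_const_mul_field c
  simp only [opL, h1, h2]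
  ring

theorem opL_sub (σ r : ℝ) {f g : ℝ → ℝ} (hf : ContDiff ℝ 2 f) (hg : ContDiff ℝ 2 g) (x : ℝ) :
    opL σ r (fun y => f y - g y) x = opL σ r f x - opL σ r g x := by
  have h := opL_add σ r hf ((contDiff_const (c := (-1 : ℝ))).mul hg) x
  rw [opL_const_mul] at h
  have e : (fun y => f y - g y) = fun y => f y + -1 * g y := by
    funext y
    ring
  rw [e, h]
  ring

/-- Follows from `|sinh| ≤ cosh`; the absolute values avoid any sign condition on `r`. -/
theorem opL_cosh_le (σ r : ℝ) {k : ℝ} (hk : 0 ≤ k) (x : ℝ) :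
    opL σ r (fun y => Real.cosh (k * y)) x
      ≤ (σ ^ 2 / 2 * k ^ 2 + |r - σ ^ 2 / 2| * k + |r|) * Real.cosh (k * x) := by
  have hlin : ∀ y : ℝ, HasDerivAt (fun z => k * z) k y := fun y => by
    simpa using (hasDerivAt_id y).const_mul k
  have h1 : deriv (fun y => Real.cosh (k * y)) = fun y => Real.sinh (k * y) * k :=
    funext fun y => (hlin y).cosh.deriv
  have h2 : deriv (fun y => Real.sinh (k * y) * k) x = Real.cosh (k * x) * k * k :=
    ((hlin x).sinh.mul_const k).deriv
  have habs : |Real.sinh (k * x)| ≤ Real.cosh (k * x) :=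
    abs_le_of_sq_le_sq (by nlinarith [Real.cosh_sq (k * x)]) (Real.cosh_pos _).le
  have h3 : (r - σ ^ 2 / 2) * Real.sinh (k * x) ≤ |r - σ ^ 2 / 2| * Real.cosh (k * x) :=
    (le_abs_self _).trans (by rw [abs_mul]; gcongr)
  have h4 : -r * Real.cosh (k * x) ≤ |r| * Real.cosh (k * x) :=
    mul_le_mul_of_nonneg_right (neg_le_abs r) (Real.cosh_pos _).le
  simp only [opL, h1, h2]
  nlinarith [mul_le_mul_of_nonneg_right h3 hk]

theorem exp_mul_abs_le_two_mul_cosh {k : ℝ} (x : ℝ) :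
    Real.exp (k * |x|) ≤ 2 * Real.cosh (k * x) := by
  rw [Real.cosh_eq]
  rcases abs_choice x with h | h <;> rw [h]
  · linarith [Real.exp_pos (-(k * x))]
  · rw [mul_neg]
    linarith [Real.exp_pos (k * x)]

/-- The positive barrier used in the minimum principle on the strip. -/
noncomputable def barrier (T g k x t : ℝ) : ℝ := Real.exp (g * (T - t)) * Real.cosh (k * x)

theorem barrier_pos (T g k x t : ℝ) : 0 < barrier T g k x t :=
  mul_pos (Real.exp_pos _) (Real.cosh_pos _)

theorem hasDerivAt_barrier_time (T g k x t : ℝ) :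
    HasDerivAt (fun s => barrier T g k x s) (-g * barrier T g k x t) t := by
  have h : HasDerivAt (fun s : ℝ => g * (T - s)) (g * -1) t :=
    ((hasDerivAt_id t).const_sub T).const_mul g
  refine (h.exp.mul_const (Real.cosh (k * x))).congr_deriv ?_
  simp only [barrier]
  ring

theorem contDiff_barrier_space (T g k t : ℝ) : ContDiff ℝ 2 (fun y => barrier T g k y t) := by
  unfold barrier
  fun_prop

/-- For a large rate `g`, the barrier is a strict supersolution. -/
theorem exists_barrier_strict_supersolution (σ r T : ℝ) {k : ℝ} (hk : 0 ≤ k) :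
    ∃ g : ℝ, 0 ≤ g ∧ ∀ x t,
      deriv (fun s => barrier T g k x s) t + opL σ r (fun y => barrier T g k y t) x < 0 := by
  refine ⟨σ ^ 2 / 2 * k ^ 2 + |r - σ ^ 2 / 2| * k + |r| + 1, by positivity, fun x t => ?_⟩
  set g := σ ^ 2 / 2 * k ^ 2 + |r - σ ^ 2 / 2| * k + |r| + 1 with hg
  rw [(hasDerivAt_barrier_time T g k x t).deriv]
  have h1 := opL_const_mul σ r (Real.exp (g * (T - t))) (fun y => Real.cosh (k * y)) x
  have h2 := mul_le_mul_of_nonneg_left (opL_cosh_le σ r hk x) (Real.exp_pos (g * (T - t))).le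
  have h3 := barrier_pos T g k x t
  have h4 : opL σ r (fun y => barrier T g k y t) x ≤ (g - 1) * barrier T g k x t := by
    simp only [barrier]
    rw [h1]
    refine h2.trans (le_of_eq ?_)
    rw [hg]
    ring
  linarith

/-- Outside a large interval, a function of exponential growth of rate `B` is dominated by any
positive multiple of a barrier of rate `B + 1`. -/
theorem exists_forall_lt_mul_barrier (T A B : ℝ) {g d : ℝ} (hg : 0 ≤ g) (hd : 0 < d) :
    ∃ M : ℝ, ∀ x t, M ≤ |x| → t ≤ T →
      A * Real.exp (B * |x|) < d * barrier T g (B + 1) x t := by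
  have hlim : Tendsto (fun y : ℝ => d / 2 * Real.exp y) atTop atTop :=
    Real.tendsto_exp_atTop.const_mul_atTop (by positivity)
  obtain ⟨M, hM⟩ := eventually_atTop.1 (hlim.eventually_gt_atTop A)
  refine ⟨M, fun x t hx ht => ?_⟩
  have h1 : Real.exp ((B + 1) * |x|) ≤ 2 * Real.cosh ((B + 1) * x) :=
    exp_mul_abs_le_two_mul_cosh x
  have h2 : 1 ≤ Real.exp (g * (T - t)) :=
    Real.one_le_exp (mul_nonneg hg (sub_nonneg.2 ht))
  have h3 : Real.cosh ((B + 1) * x) ≤ barrier T g (B + 1) x t :=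
    le_mul_of_one_le_left (Real.cosh_pos _).le h2
  calc A * Real.exp (B * |x|) < d / 2 * Real.exp |x| * Real.exp (B * |x|) :=
        mul_lt_mul_of_pos_right (hM _ hx) (Real.exp_pos _)
    _ = d / 2 * Real.exp ((B + 1) * |x|) := by
        rw [mul_assoc, ← Real.exp_add]
        ring_nf
    _ ≤ d / 2 * (2 * barrier T g (B + 1) x t) := by
        gcongr
        linarith
    _ = d * barrier T g (B + 1) x t := by ring

/-- Minimum principle: a supersolution of exponential growth of a linear terminal value problem
with nonnegative killing rate `q` is nonnegative if its terminal value is. -/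
theorem nonneg_of_supersolution {σ r T : ℝ} {w q : ℝ → ℝ → ℝ} (hT : 0 < T)
    (hcont : ContinuousOn (fun z : ℝ × ℝ => w z.1 z.2) (univ ×ˢ Icc 0 T))
    (htime : ∀ x, ∀ t ∈ Ioo 0 T, DifferentiableAt ℝ (fun s => w x s) t)
    (hspace : ∀ t ∈ Ioo 0 T, ContDiff ℝ 2 (fun y => w y t))
    (hgrowth : ∃ A B : ℝ, ∀ x, ∀ t ∈ Icc 0 T, |w x t| ≤ A * Real.exp (B * |x|))
    (hq : ∀ x, ∀ t ∈ Ioo 0 T, 0 ≤ q x t)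
    (hpde : ∀ x, ∀ t ∈ Ioo 0 T,
      deriv (fun s => w x s) t + opL σ r (fun y => w y t) x - q x t * w x t ≤ 0)
    (hterm : ∀ x, 0 ≤ w x T) :
    ∀ x, ∀ t ∈ Icc 0 T, 0 ≤ w x t := by
  -- The equation is not available at time 0, so the box must start at some `t₁ > 0`; continuity
  -- recovers the endpoints.
  suffices hopen : ∀ x, ∀ t ∈ Ioo 0 T, 0 ≤ w x t by
    intro x t ht
    rw [← closure_Ioo hT.ne] at ht
    have hc : ContinuousOn (fun s => w x s) (closure (Ioo 0 T)) := by
      rw [closure_Ioo hT.ne]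
      exact hcont.comp (f := fun s : ℝ => (x, s)) (by fun_prop) fun s hs => ⟨mem_univ _, hs⟩
    exact le_on_closure (f := fun _ => (0 : ℝ)) (hopen x) continuousOn_const hc ht
  intro x₁ t₁ ht₁
  by_contra! hneg
  obtain ⟨A, B₀, hA₀⟩ := hgrowth
  obtain ⟨B, hB, hA⟩ : ∃ B : ℝ, 0 ≤ B ∧ ∀ x, ∀ t ∈ Icc 0 T, |w x t| ≤ A * Real.exp (B * |x|) := by
    refine ⟨max B₀ 0, le_max_right _ _, fun x t ht => (hA₀ x t ht).trans ?_⟩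
    have hA0 : 0 ≤ A := by
      have := (abs_nonneg _).trans (hA₀ x t ht)
      exact nonneg_of_mul_nonneg_left this (Real.exp_pos _)
    gcongr
    exact le_max_left _ _
  obtain ⟨g, hg, hstrict⟩ :=
    exists_barrier_strict_supersolution σ r T (k := B + 1) (by linarith)
  set φ : ℝ → ℝ → ℝ := barrier T g (B + 1) with hφ
  have hφpos : ∀ x t, 0 < φ x t := barrier_pos T g (B + 1)
  -- With this multiple, `w / φ` exceeds its value at `(x₁, t₁)` wherever `|x| ≥ M`, which keeps its
  -- minimum off the lateral sides.
  obtain ⟨M, hM⟩ := exists_forall_lt_mul_barrier T A B hg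
    (d := -(w x₁ t₁ / φ x₁ t₁)) (neg_pos.2 (div_neg_of_neg_of_pos hneg (hφpos _ _)))
  set R := max M |x₁| with hR
  have hcompact : IsCompact (Icc (-R) R ×ˢ Icc t₁ T) := isCompact_Icc.prod isCompact_Icc
  have hmem₁ : (x₁, t₁) ∈ Icc (-R) R ×ˢ Icc t₁ T :=
    ⟨abs_le.1 (le_max_right _ _), left_mem_Icc.2 ht₁.2.le⟩
  have hzcont : ContinuousOn (fun z : ℝ × ℝ => w z.1 z.2 / φ z.1 z.2)
      (Icc (-R) R ×ˢ Icc t₁ T) := by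
    refine (hcont.mono ?_).div (Continuous.continuousOn ?_) fun z _ => (hφpos _ _).ne'
    · exact prod_mono (subset_univ _) (Icc_subset_Icc_left ht₁.1.le)
    · simp only [hφ, barrier]
      fun_prop
  obtain ⟨⟨x, t⟩, ⟨hx, ht⟩, hmin⟩ := hcompact.exists_isMinOn ⟨_, hmem₁⟩ hzcont
  simp only at hx ht
  set m := w x t / φ x t with hm
  have hm₁ : m ≤ w x₁ t₁ / φ x₁ t₁ := hmin hmem₁
  have hmneg : m < 0 := hm₁.trans_lt (div_neg_of_neg_of_pos hneg (hφpos _ _))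
  have hwm : w x t = m * φ x t := (div_mul_cancel₀ _ (hφpos x t).ne').symm
  -- `w - m φ` touches zero from above at `(x, t)`, so `∂ₜ + L` of it is nonnegative there, whereas
  -- the supersolution inequality and the strict barrier make it negative.
  have hw : ∀ y s, y ∈ Icc (-R) R → s ∈ Icc t₁ T → 0 ≤ w y s + -m * φ y s := by
    intro y s hy hs
    have h : m ≤ w y s / φ y s := hmin (show (y, s) ∈ _ from ⟨hy, hs⟩)
    rw [le_div_iff₀ (hφpos y s)] at h
    linarith
  have htT : t < T := by
    refine lt_of_le_of_ne ht.2 ?_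
    rintro rfl
    nlinarith [hterm x, hφpos x t]
  have htI : t ∈ Ioo 0 T := ⟨ht₁.1.trans_le ht.1, htT⟩
  have hxI : |x| < R := by
    by_contra! hxR
    have h1 := hM x t ((le_max_left _ _).trans hxR) htT.le
    have h2 := (neg_le_abs (w x t)).trans (hA x t (Ioo_subset_Icc_self htI))
    nlinarith [hφpos x t]
  have hφt : DifferentiableAt ℝ (fun s => φ x s) t :=
    (hasDerivAt_barrier_time T g (B + 1) x t).differentiableAt
  have hφx : ContDiff ℝ 2 (fun y => φ y t) := contDiff_barrier_space T g (B + 1) t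
  have hφx' : ContDiff ℝ 2 (fun y => -m * φ y t) := contDiff_const.mul hφx
  have hdt : 0 ≤ deriv (fun s => w x s + -m * φ x s) t := by
    refine nonneg_deriv_of_forall_Ico_le htT ((htime x t htI).add (hφt.const_mul _)) fun s hs => ?_
    have := hw x s hx ⟨ht.1.trans hs.1, hs.2.le⟩
    linarith
  rw [deriv_fun_add (htime x t htI) (hφt.const_mul _), deriv_const_mul_field] at hdt
  have hlocal : IsLocalMin (fun y => w y t + -m * φ y t) x := by
    filter_upwards [Ioo_mem_nhds (abs_lt.1 hxI).1 (abs_lt.1 hxI).2] with y hy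
    have := hw y t (Ioo_subset_Icc_self hy) ht
    linarith
  have hopL : 0 ≤ opL σ r (fun y => w y t + -m * φ y t) x := by
    have h2 := nonneg_deriv_deriv_of_isLocalMin ((hspace t htI).add hφx') hlocal
    have h0 : w x t + -m * φ x t = 0 := by linarith
    simp only [opL, hlocal.deriv_eq_zero, h0]
    have := mul_nonneg (by positivity : 0 ≤ σ ^ 2 / 2) h2
    linarith
  rw [opL_add σ r (hspace t htI) hφx', opL_const_mul] at hopL
  have h1 := mul_neg_of_pos_of_neg (neg_pos.2 hmneg) (hstrict x t)
  have h2 := hpde x t htI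
  have h3 : q x t * w x t ≤ 0 := by
    rw [hwm]
    exact mul_nonpos_of_nonneg_of_nonpos (hq x t htI)
      (mul_nonpos_of_nonpos_of_nonneg hmneg.le (hφpos x t).le)
  linarith

/-- Comparison of two classical solutions whose nonlinearities, evaluated along them, differ by at
least a nonnegative killing term. -/
theorem IsClassicalSolution.le_of_killing_le {σ r K T : ℝ} {F G : ℝ → ℝ → ℝ → ℝ}
    {u v q : ℝ → ℝ → ℝ} (hT : 0 < T) (hu : IsClassicalSolution σ r K T F u)
    (hv : IsClassicalSolution σ r K T G v) (hq : ∀ x, ∀ t ∈ Ioo 0 T, 0 ≤ q x t)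
    (hFG : ∀ x, ∀ t ∈ Ioo 0 T, -(q x t * (v x t - u x t)) ≤ G x t (v x t) - F x t (u x t)) :
    ∀ x, ∀ t ∈ Icc 0 T, u x t ≤ v x t := by
  intro x t ht
  refine sub_nonneg.1 (nonneg_of_supersolution (σ := σ) (r := r) (q := q)
    (w := fun x t => v x t - u x t) hT (hv.continuousOn.sub hu.continuousOn)
    (fun x t ht => (hv.isC21.differentiableAt_time x t ht).sub
      (hu.isC21.differentiableAt_time x t ht))
    (fun t ht => (hv.isC21.contDiff_space t ht).sub (hu.isC21.contDiff_space t ht))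
    ?_ hq ?_ (fun x => by simp [hv.terminal, hu.terminal]) x t ht)
  · obtain ⟨A, B, hA⟩ := hu.growth
    obtain ⟨A', B', hA'⟩ := hv.growth
    refine ⟨|A'| + |A|, max B' B, fun x t ht => ?_⟩
    have h1 : |v x t| ≤ |A'| * Real.exp (max B' B * |x|) := by
      refine (hA' x t ht).trans ?_
      gcongr
      exacts [le_abs_self _, le_max_left _ _]
    have h2 : |u x t| ≤ |A| * Real.exp (max B' B * |x|) := by
      refine (hA x t ht).trans ?_
      gcongr
      exacts [le_abs_self _, le_max_right _ _]
    have h3 := abs_sub (v x t) (u x t)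
    linarith
  · intro x t ht
    rw [deriv_fun_sub (hv.isC21.differentiableAt_time x t ht)
      (hu.isC21.differentiableAt_time x t ht),
      opL_sub σ r (hv.isC21.contDiff_space t ht) (hu.isC21.contDiff_space t ht)]
    linarith [hv.pde x t ht, hu.pde x t ht, hFG x t ht]

theorem hamiltonian_le_improvedPolicy {K lam x v p : ℝ} (hlam : 0 < lam) (hp : 0 < p) :
    hamiltonian K lam x p v ≤ hamiltonian K lam x (improvedPolicy K lam x v) v := by
  by_cases h : p = improvedPolicy K lam x v
  · rw [← h]
  · exact (hamiltonian_lt_improvedPolicy hlam hp h).le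

theorem hamiltonian_improvedPolicy {K lam x v : ℝ} (hlam : 0 < lam) :
    hamiltonian K lam x (improvedPolicy K lam x v) v
      = lam * Real.exp (-(v - payoff K x) / lam) := by
  simp only [hamiltonian, entropyTerm, improvedPolicy, Real.log_exp]
  field_simp
  ring

theorem hamiltonian_sub_hamiltonian (K lam x p v w : ℝ) :
    hamiltonian K lam x p v - hamiltonian K lam x p w = -(p * (v - w)) := by
  simp only [hamiltonian]
  ring

end ExploratoryStopping

open ExploratoryStopping in
theorem mainTheorem2
    (σ r K T lam : ℝ) (hσ : 0 < σ) (hK : 0 < K) (hT : 0 < T) (hlam : 0 < lam)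
    (u0 : ℝ →ᵇ ℝ) (u p : ℕ → ℝ → ℝ → ℝ)
    (hiter : ExploratoryStopping.IsPolicyIteration σ r K T lam u0 u p)
    (uopt : ℝ → ℝ → ℝ)
    (hopt : ExploratoryStopping.IsOptimalValueFunction σ r K T lam uopt) :
    ∀ n : ℕ, 1 ≤ n → ∀ x : ℝ, ∀ t ∈ Set.Icc 0 T,
      u n x t ≤ u (n + 1) x t ∧ u (n + 1) x t ≤ uopt x t := by
  have hpos : ∀ n x, ∀ t ∈ Ioo 0 T, 0 < p (n + 1) x t := fun n x t ht => by
    rw [hiter.update n x t (Ioo_subset_Icc_self ht)]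
    exact Real.exp_pos _
  intro n hn x t ht
  -- The initial guess solves no equation, so comparison needs the index to be a successor.
  obtain ⟨k, rfl⟩ := Nat.exists_eq_add_of_le' hn
  constructor
  · refine IsClassicalSolution.le_of_killing_le hT (hiter.evaluation k) (hiter.evaluation (k + 1))
      (fun x t ht => (hpos (k + 1) x t ht).le) (fun x t ht => ?_) x t ht
    -- At the old value, the new policy does at least as well as the old one.
    have h := hamiltonian_le_improvedPolicy (K := K) (x := x) (v := u (k + 1) x t) hlam
      (hpos k x t ht)
    rw [← hiter.update (k + 1) x t (Ioo_subset_Icc_self ht)] at h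
    linarith [hamiltonian_sub_hamiltonian K lam x (p (k + 1 + 1) x t) (u (k + 1 + 1) x t)
      (u (k + 1) x t)]
  · refine IsClassicalSolution.le_of_killing_le hT (hiter.evaluation (k + 1)) hopt
      (fun x t ht => (hpos (k + 1) x t ht).le) (fun x t ht => ?_) x t ht
    have h := hamiltonian_le_improvedPolicy (K := K) (x := x) (v := uopt x t) hlam
      (hpos (k + 1) x t ht)
    rw [hamiltonian_improvedPolicy hlam] at h
    linarith [hamiltonian_sub_hamiltonian K lam x (p (k + 1 + 1) x t) (uopt x t)
      (u (k + 1 + 1) x t)]
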